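/- Let $1\le\alpha<2$, let $m_1,\dots,m_N>0$ be masses and $c_1,\dots,c_N\in\mathbb{C}$ distinct centers with $c_1=0$, and put $V(z)=\sum_{j=1}^N \frac{m_j}{\alpha|z-c_j|^{\alpha}}$. Let $\delta>0$ and let $y:[-\delta,\delta]\to\mathbb{C}$ be an isolated collision solution of the $N$-center problem with $y(0)=c_1=0$; that is, $y$ is continuous, and for all $t\in[-\delta,\delta]\setminus\{0\}$ one has $y(t)\notin\{c_1,\dots,c_N\}$, $y$ is twice differentiable at $t$ with $$\ddot y(t)=\nabla V(y(t))=-\sum_{j=1}^N\frac{m_j\,(y(t)-c_j)}{|y(t)-c_j|^{\alpha+2}},$$ and $\tfrac12|\dot y(t)|^2-V(y(t))=h$ with a constant $h\in\mathbb{R}$ that is the same for all $t\neq0$ (derivatives at $\pm\delta$ are one-sided). Write $y(t)=|y(t)|e^{i\theta(t)}$ with $\theta$ real-valued and continuous on $[-\delta,0)$ and on $(0,\delta]$. Then the limits $\theta_{\pm}=\lim_{t\to0^{\pm}}\theta(t)$ exist and are finite. Let $$\bar y(t)=\begin{cases}(\mu|t|)^{\frac{2}{\alpha+2}}e^{i\theta_+},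 & t\ge 0,\\ (\mu|t|)^{\frac{2}{\alpha+2}}e^{i\theta_-}, & t\le 0,\end{cases}\qquad \mu=(\alpha+2)\Big(\frac{m_1}{2\alpha}\Big)^{1/2},$$ and, for $\lambda>0$, let $y_\lambda(t)=\lambda^{-\frac{2}{2+\alpha}}y(\lambda t)$ for $t\in[-\delta/\lambda,\delta/\lambda]$. For every $T>0$ there is a strictly decreasing sequence of positive numbers $\lambda_n\to0$, with $\lambda_nT<\delta$ for all $n$, such that 1. $y_{\lambda_n}$ converges uniformly to $\bar y$ on $[-T,T]$; 2. $\dot y_{\lambda_n}$ converges uniformly to $\dot{\bar y}$ on every compact subset of $[-T,T]\setminus\{0\}$. -/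

import Mathlib

namespace NCenter

noncomputable section

/-- The negative potential `V(z) = ∑ⱼ mⱼ / (α |z - cⱼ|^α)` of the planar `N`-center problem. -/
def potential {N : ℕ} (α : ℝ) (m : Fin N → ℝ) (c : Fin N → ℂ) (z : ℂ) : ℝ :=
  ∑ j, m j / (α * ‖z - c j‖ ^ α)

/-- The force field `∇V(z) = - ∑ⱼ mⱼ (z - cⱼ) / |z - cⱼ|^(α+2)`. -/
def force {N : ℕ} (α : ℝ) (m : Fin N → ℝ) (c : Fin N → ℂ) (z : ℂ) : ℂ :=
  -∑ j, (m j / ‖z - c j‖ ^ (α + 2)) • (z - c j)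

/-- `y : [t₀ - δ, t₀ + δ] → ℂ` is an isolated collision solution of the `N`-center problem.
A curve on the closed interval is represented by a function on `ℝ`, of which only the values on
that interval matter; derivatives are taken within the interval (so they are two-sided
at interior points and one-sided at the two end points). -/
structure IsIsolatedCollisionSolution {N : ℕ} (α : ℝ) (m : Fin N → ℝ) (c : Fin N → ℂ)
    (t₀ δ : ℝ) (y : ℝ → ℂ) : Prop where
  delta_pos : 0 < δ
  continuousOn : ContinuousOn y (Set.Icc (t₀ - δ) (t₀ + δ))
  collision : y t₀ ∈ Set.range c
  collisionFree : ∀ t ∈ Set.Icc (t₀ - δ) (t₀ + δ), t ≠ t₀ → y t ∉ Set.range c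
  differentiable : ∀ t ∈ Set.Icc (t₀ - δ) (t₀ + δ), t ≠ t₀ →
    DifferentiableWithinAt ℝ y (Set.Icc (t₀ - δ) (t₀ + δ)) t
  equation : ∀ t ∈ Set.Icc (t₀ - δ) (t₀ + δ), t ≠ t₀ →
    HasDerivWithinAt (derivWithin y (Set.Icc (t₀ - δ) (t₀ + δ))) (force α m c (y t))
      (Set.Icc (t₀ - δ) (t₀ + δ)) t
  energy : ∃ h : ℝ, ∀ t ∈ Set.Icc (t₀ - δ) (t₀ + δ), t ≠ t₀ →
    1 / 2 * ‖derivWithin y (Set.Icc (t₀ - δ) (t₀ + δ)) t‖ ^ 2 - potential α m c (y t) = h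

/-- `θ` is a polar angle of `y` on `[-δ, δ] \ {0}`: it is continuous there, that is, continuous on
each of `[-δ, 0)` and `(0, δ]`, and `y(t) = |y(t)| e^{iθ(t)}`. -/
structure IsPolarAngle (δ : ℝ) (y : ℝ → ℂ) (θ : ℝ → ℝ) : Prop where
  continuousOn : ContinuousOn θ (Set.Icc (-δ) δ \ {0})
  polar : ∀ t ∈ Set.Icc (-δ) δ \ {0}, y t = ‖y t‖ * Complex.exp (θ t * Complex.I)

/-- The constant `μ = (α + 2) (m₁ / (2α))^(1/2)`. -/
def mu (α m₁ : ℝ) : ℝ := (α + 2) * (m₁ / (2 * α)) ^ (1 / 2 : ℝ)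

/-- The parabolic collision-ejection solution with angles `φm` (for `t ≤ 0`) and `φp`
(for `t ≥ 0`) of the Kepler-type problem with mass `m₁`. -/
def collisionEjection (α m₁ φm φp : ℝ) (t : ℝ) : ℂ :=
  if 0 ≤ t then (((mu α m₁ * |t|) ^ (2 / (α + 2)) : ℝ) : ℂ) * Complex.exp (φp * Complex.I)
  else (((mu α m₁ * |t|) ^ (2 / (α + 2)) : ℝ) : ℂ) * Complex.exp (φm * Complex.I)

/-- The `r`-rescale `y_r(t) = r^(-2/(2+α)) y(r t)` with respect to a center at the origin. -/
def rescale (α r : ℝ) (y : ℝ → ℂ) (t : ℝ) : ℂ :=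
  ((r ^ (-(2 / (2 + α))) : ℝ) : ℂ) * y (r * t)

end

end NCenter

/-! Near the collision the motion is a Kepler problem with potential `m₁ / (α * r ^ α)`, `r = ‖y‖`,
up to bounded perturbations of the force and of the energy. Hence `r ^ α * ‖y'‖ ^ 2 → 2 * m₁ / α`
and, by the Lagrange-Jacobi identity, `r ^ α * (r * r')' → (2 - α) / α * m₁ > 0`, so `r` increases
after the collision. The derivative of the angular momentum `r ^ 2 * θ'` is `O(r)`, and by
monotonicity of `r` the angular momentum is `O(r * t)`. Its share of the kinetic energy is therefore
negligible, which leaves `r ^ (α / 2) * r' → √(2 * m₁ / α)`, and L'Hôpital's rule gives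
`r ^ ((α + 2) / 2) / t → μ`. Moreover `θ' = O(t / r)` is bounded, so `θ` has a limit. Negative times
follow by time reversal.

Thus `y` and `y'` are asymptotically equivalent, at the collision, to the collision-ejection
solution and its derivative. The latter are positively homogeneous, so the blow-ups of `y` and `y'`
converge to them locally uniformly. -/

namespace NCenter

open Filter Topology Asymptotics ComplexConjugate Set

section RightLimit

variable {E : Type*} [NormedAddCommGroup E] [NormedSpace ℝ E] {a b : ℝ}

theorem norm_sub_le_of_tendsto_nhdsGT {f f' : ℝ → E} {l : E} {M : ℝ} (hab : a < b)
    (hf : ∀ t ∈ Ioc a b, HasDerivAt f (f' t) t) (hM : ∀ t ∈ Ioc a b, ‖f' t‖ ≤ M)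
    (hl : Tendsto f (𝓝[>] a) (𝓝 l)) : ‖f b - l‖ ≤ M * (b - a) := by
  have hs : ∀ᶠ s in 𝓝[>] a, ‖f b - f s‖ ≤ M * (b - s) := by
    filter_upwards [Ioo_mem_nhdsGT hab] with s hs
    have hsub : Icc s b ⊆ Ioc a b := Icc_subset_Ioc hs.1 le_rfl
    simpa [Real.norm_of_nonneg (sub_nonneg.2 hs.2.le)] using
      (convex_Icc s b).norm_image_sub_le_of_norm_hasDerivWithin_le
        (fun t ht => (hf t (hsub ht)).hasDerivWithinAt) (fun t ht => hM t (hsub ht))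
        (left_mem_Icc.2 hs.2.le) (right_mem_Icc.2 hs.2.le)
  have hid : Tendsto (fun s : ℝ => s) (𝓝[>] a) (𝓝 a) := nhdsWithin_le_nhds
  exact le_of_tendsto_of_tendsto (tendsto_const_nhds.sub hl).norm
    ((tendsto_const_nhds.sub hid).const_mul M) hs

theorem exists_tendsto_nhdsGT_of_hasDerivAt_isBigO_one [CompleteSpace E] {f f' : ℝ → E}
    (hf : ∀ᶠ t in 𝓝[>] a, HasDerivAt f (f' t) t) (hf' : f' =O[𝓝[>] a] fun _ => (1 : ℝ)) :
    ∃ l, Tendsto f (𝓝[>] a) (𝓝 l) := by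
  obtain ⟨M, hM⟩ := hf'.bound
  obtain ⟨b, hb, H⟩ := (nhdsGT_basis a).eventually_iff.1 (hf.and hM)
  have hlip : LipschitzOnWith M.toNNReal f (Ioo a b) := by
    refine (convex_Ioo a b).lipschitzOnWith_of_nnnorm_hasDerivWithin_le
      (fun t ht => (H ht).1.hasDerivWithinAt) fun t ht => ?_
    simpa using Real.toNNReal_le_toNNReal (H ht).2
  refine cauchy_map_iff_exists_tendsto.1 (cauchy_map_iff.2 ⟨inferInstance, ?_⟩)
  refine hlip.uniformContinuousOn.mono_left (le_inf (cauchy_nhds.mono nhdsWithin_le_nhds).2 ?_)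
  exact le_principal_iff.2 (prod_mem_prod (Ioo_mem_nhdsGT hb) (Ioo_mem_nhdsGT hb))

theorem exists_strictMonoOn_Ioo_of_hasDerivAt_pos {f f' : ℝ → ℝ}
    (hf : ∀ᶠ t in 𝓝[>] a, HasDerivAt f (f' t) t) (hf' : ∀ᶠ t in 𝓝[>] a, 0 < f' t) :
    ∃ b > a, StrictMonoOn f (Ioo a b) := by
  obtain ⟨b, hb, H⟩ := (nhdsGT_basis a).eventually_iff.1 (hf.and hf')
  refine ⟨b, hb, strictMonoOn_of_hasDerivWithinAt_pos (f' := f') (convex_Ioo a b)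
    (fun t ht => (H ht).1.continuousAt.continuousWithinAt) ?_ ?_⟩
  · exact fun t ht => (H (interior_subset ht)).1.hasDerivWithinAt
  · exact fun t ht => (H (interior_subset ht)).2

theorem lt_of_strictMonoOn_Ioo_of_tendsto_nhdsGT {f : ℝ → ℝ} {l t : ℝ}
    (hf : StrictMonoOn f (Ioo a b)) (hl : Tendsto f (𝓝[>] a) (𝓝 l)) (ht : t ∈ Ioo a b) :
    l < f t := by
  obtain ⟨s, has, hst⟩ := exists_between ht.1
  have hs : s ∈ Ioo a b := ⟨has, hst.trans ht.2⟩
  have hls : l ≤ f s := by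
    refine le_of_tendsto hl ?_
    filter_upwards [Ioc_mem_nhdsGT has] with u hu
    exact hf.monotoneOn ⟨hu.1, hu.2.trans_lt hs.2⟩ hs hu.2
  exact hls.trans_lt (hf hs ht hst)

end RightLimit

section PolarAngle

theorem arg_div_eq_sub {z w : ℂ} {a b : ℝ} (hz : z ≠ 0) (hw : w ≠ 0)
    (hza : z = ‖z‖ * Complex.exp (a * Complex.I)) (hwb : w = ‖w‖ * Complex.exp (b * Complex.I))
    (hab : |a - b| < Real.pi) : (z / w).arg = a - b := by
  have hquot : z / w = (‖z‖ / ‖w‖ : ℝ) * Complex.exp ((a - b : ℝ) * Complex.I) := by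
    conv_lhs => rw [hza, hwb, mul_div_mul_comm, ← Complex.exp_sub, ← sub_mul]
    push_cast
    rfl
  have hpos : 0 < ‖z‖ / ‖w‖ := div_pos (norm_pos_iff.2 hz) (norm_pos_iff.2 hw)
  rw [hquot, Complex.exp_mul_I, Complex.arg_mul_cos_add_sin_mul_I hpos
    ⟨(abs_lt.1 hab).1, (abs_lt.1 hab).2.le⟩]

theorem hasDerivAt_polarAngle {y : ℝ → ℂ} {θ : ℝ → ℝ} {t : ℝ} {y' : ℂ}
    (hy : HasDerivAt y y' t) (hne : y t ≠ 0) (hθ : ContinuousAt θ t)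
    (hpolar : ∀ᶠ s in 𝓝 t, y s = ‖y s‖ * Complex.exp (θ s * Complex.I)) :
    HasDerivAt θ (y' / y t).im t := by
  have hlog : HasDerivAt (fun s => (Complex.log (y s / y t)).im) (y' / y t).im t := by
    have := Complex.imCLM.hasFDerivAt.comp_hasDerivAt t
      ((hy.div_const (y t)).clog_real (by simp [hne]))
    rwa [div_self hne, div_one] at this
  have hnear : ∀ᶠ s in 𝓝 t, |θ s - θ t| < Real.pi :=
    Metric.continuousAt_iff'.1 hθ _ Real.pi_pos
  refine (hlog.add_const (θ t)).congr_of_eventuallyEq ?_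
  filter_upwards [hpolar, hnear, hy.continuousAt.eventually_ne hne] with s hs hlt hs0
  rw [Complex.log_im, arg_div_eq_sub hs0 hne hs hpolar.self_of_nhds hlt, sub_add_cancel]

theorem exp_mul_I_isEquivalent {ι : Type*} {l : Filter ι} {θ : ι → ℝ} {θ₀ : ℝ}
    (hθ : Tendsto θ l (𝓝 θ₀)) :
    (fun t => Complex.exp (θ t * Complex.I)) ~[l] fun _ => Complex.exp (θ₀ * Complex.I) :=
  (isEquivalent_const_iff_tendsto (Complex.exp_ne_zero _)).2
    (((Complex.continuous_ofReal.tendsto θ₀).comp hθ).mul_const Complex.I).cexp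

end PolarAngle

section Blowup

variable {E F : Type*} [NormedAddCommGroup E] [NormedSpace ℝ E] [NormedAddCommGroup F]
  [NormedSpace ℝ F] {q : ℝ}

/-- Positive homogeneity of degree `q`: the blow-ups `r ^ (-q) • G (r • x)` with `0 < r` all
coincide with `G`, so that `G` can be the limit of the blow-ups of another map. -/
def IsPosHomogeneous (q : ℝ) (G : E → F) : Prop :=
  ∀ r : ℝ, 0 < r → ∀ x, G (r • x) = r ^ q • G x

theorem IsPosHomogeneous.rpow_neg_smul_apply {G : E → F} (hG : IsPosHomogeneous q G) {r : ℝ}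
    (hr : 0 < r) (x : E) : r ^ (-q) • G (r • x) = G x := by
  rw [hG r hr, smul_smul, ← Real.rpow_add hr, neg_add_cancel, Real.rpow_zero, one_smul]

theorem IsPosHomogeneous.deriv {G : ℝ → F} (hG : IsPosHomogeneous q G) :
    IsPosHomogeneous (q - 1) (_root_.deriv G) := by
  intro r hr t
  have hscale : r • _root_.deriv G (r • t) = r ^ q • _root_.deriv G t := by
    rw [smul_eq_mul, ← deriv_comp_mul_left, ← deriv_const_smul_field]
    exact congrArg (_root_.deriv · t) (funext (hG r hr))
  rw [Real.rpow_sub_one hr.ne', div_eq_inv_mul, mul_smul, ← hscale, inv_smul_smul₀ hr.ne']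

theorem IsPosHomogeneous.continuousOn_compl_zero {G : ℝ → F} (hG : IsPosHomogeneous q G) :
    ContinuousOn G {0}ᶜ := by
  intro t ht
  refine ContinuousAt.continuousWithinAt ?_
  rcases lt_or_gt_of_ne (mem_compl_singleton_iff.1 ht) with h | h
  · have hneg : (fun s : ℝ => (-s) ^ q • G (-1)) =ᶠ[𝓝 t] G := by
      filter_upwards [Iio_mem_nhds h] with s hs
      simpa using (hG (-s) (neg_pos.2 hs) (-1)).symm
    exact ((continuousAt_neg.rpow_const (Or.inl (neg_ne_zero.2 h.ne))).smul
      continuousAt_const).congr hneg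
  · have hpos : (fun s : ℝ => s ^ q • G 1) =ᶠ[𝓝 t] G := by
      filter_upwards [Ioi_mem_nhds h] with s hs
      simpa using (hG s hs 1).symm
    exact ((continuousAt_id.rpow_const (Or.inl h.ne')).smul continuousAt_const).congr hpos

theorem IsPosHomogeneous.tendstoLocallyUniformlyOn_blowup {f G : E → F} {S : Set E}
    (hG : IsPosHomogeneous q G) (hGS : ContinuousOn G S) (hS : ∀ r : ℝ, 0 < r → ∀ x ∈ S, r • x ∈ S)
    (hfG : f ~[𝓝[S] 0] G) :
    TendstoLocallyUniformlyOn (fun r x => r ^ (-q) • f (r • x)) G (𝓝[>] (0 : ℝ)) S := by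
  refine tendstoLocallyUniformlyOn_iff_forall_tendsto.2 fun x hx => ?_
  have hpos : ∀ᶠ p : ℝ × E in 𝓝[>] 0 ×ˢ 𝓝[S] x, 0 < p.1 :=
    tendsto_fst.eventually self_mem_nhdsWithin
  have hmem : ∀ᶠ p : ℝ × E in 𝓝[>] 0 ×ˢ 𝓝[S] x, p.2 ∈ S :=
    tendsto_snd.eventually self_mem_nhdsWithin
  have hsmul : Tendsto (fun p : ℝ × E => p.1 • p.2) (𝓝[>] 0 ×ˢ 𝓝[S] x) (𝓝[S] 0) := by
    refine tendsto_nhdsWithin_iff.2 ⟨?_, ?_⟩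
    · have hfst : Tendsto (fun p : ℝ × E => p.1) (𝓝[>] 0 ×ˢ 𝓝[S] x) (𝓝 0) :=
        tendsto_fst.mono_right nhdsWithin_le_nhds
      have hsnd : Tendsto (fun p : ℝ × E => p.2) (𝓝[>] (0 : ℝ) ×ˢ 𝓝[S] x) (𝓝 x) :=
        tendsto_snd.mono_right nhdsWithin_le_nhds
      simpa using hfst.smul hsnd
    · filter_upwards [hpos, hmem] with p hp₁ hp₂ using hS _ hp₁ _ hp₂
  have hGx : (fun p : ℝ × E => G p.2) =O[𝓝[>] (0 : ℝ) ×ˢ 𝓝[S] x] fun _ => (1 : ℝ) :=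
    ((hGS x hx).tendsto.comp tendsto_snd).isBigO_one ℝ
  have herr : (fun p : ℝ × E => p.1 ^ (-q) • (f (p.1 • p.2) - G (p.1 • p.2)))
      =o[𝓝[>] 0 ×ˢ 𝓝[S] x] fun p => G p.2 := by
    refine ((isBigO_refl (fun p : ℝ × E => p.1 ^ (-q)) _).smul_isLittleO
      (hfG.isLittleO.comp_tendsto hsmul)).congr' .rfl ?_
    filter_upwards [hpos] with p hp using hG.rpow_neg_smul_apply hp p.2
  refine tendsto_uniformity_iff_dist_tendsto_zero.2
    (((isLittleO_one_iff ℝ).1 (herr.trans_isBigO hGx)).norm.congr' ?_ |>.trans (by simp))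
  filter_upwards [hpos] with p hp
  rw [dist_comm, dist_eq_norm, smul_sub, hG.rpow_neg_smul_apply hp]

end Blowup

section Kinematics

variable {y : ℝ → ℂ} {t : ℝ}

/-- Half the derivative of `‖y‖ ^ 2`; in polar coordinates `y = r * exp (θ * I)` it is `r * r'`. -/
noncomputable def radialMomentum (y : ℝ → ℂ) (t : ℝ) : ℝ := (conj (y t) * deriv y t).re

/-- The angular momentum; in polar coordinates `y = r * exp (θ * I)` it is `r ^ 2 * θ'`. -/
noncomputable def angularMomentum (y : ℝ → ℂ) (t : ℝ) : ℝ := (conj (y t) * deriv y t).im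

theorem radialMomentum_sq_add_angularMomentum_sq (y : ℝ → ℂ) (t : ℝ) :
    radialMomentum y t ^ 2 + angularMomentum y t ^ 2 = ‖y t‖ ^ 2 * ‖deriv y t‖ ^ 2 := by
  rw [← mul_pow, ← Complex.norm_conj (y t), ← norm_mul, Complex.sq_norm, Complex.normSq_apply,
    radialMomentum, angularMomentum, sq, sq]

theorem hasDerivAt_norm_radialMomentum (hy : DifferentiableAt ℝ y t) (hne : y t ≠ 0) :
    HasDerivAt (fun s => ‖y s‖) (radialMomentum y t / ‖y t‖) t := by
  have hsqrt := hy.hasDerivAt.norm_sq.sqrt (by simpa using hne)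
  simp only [Real.sqrt_sq (norm_nonneg _)] at hsqrt
  rwa [mul_div_mul_left _ _ two_ne_zero, Complex.inner, mul_comm] at hsqrt

theorem hasDerivAt_conj_mul_deriv (hy : DifferentiableAt ℝ y t)
    (hy' : DifferentiableAt ℝ (deriv y) t) :
    HasDerivAt (fun s => conj (y s) * deriv y s)
      ((‖deriv y t‖ ^ 2 : ℝ) + conj (y t) * deriv (deriv y) t) t := by
  refine (hy.hasDerivAt.star.mul hy'.hasDerivAt).congr_deriv ?_
  rw [← Complex.normSq_eq_norm_sq, Complex.normSq_eq_conj_mul_self]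
  rfl

theorem hasDerivAt_radialMomentum (hy : DifferentiableAt ℝ y t)
    (hy' : DifferentiableAt ℝ (deriv y) t) :
    HasDerivAt (radialMomentum y)
      (‖deriv y t‖ ^ 2 + (conj (y t) * deriv (deriv y) t).re) t := by
  refine (Complex.reCLM.hasFDerivAt.comp_hasDerivAt t
    (hasDerivAt_conj_mul_deriv hy hy')).congr_deriv ?_
  rw [Complex.reCLM_apply, Complex.add_re, Complex.ofReal_re]

theorem hasDerivAt_angularMomentum (hy : DifferentiableAt ℝ y t)
    (hy' : DifferentiableAt ℝ (deriv y) t) :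
    HasDerivAt (angularMomentum y) (conj (y t) * deriv (deriv y) t).im t := by
  refine (Complex.imCLM.hasFDerivAt.comp_hasDerivAt t
    (hasDerivAt_conj_mul_deriv hy hy')).congr_deriv ?_
  rw [Complex.imCLM_apply, Complex.add_im, Complex.ofReal_im, zero_add]

theorem im_deriv_div_eq_angularMomentum_div (y : ℝ → ℂ) (t : ℝ) :
    (deriv y t / y t).im = angularMomentum y t / ‖y t‖ ^ 2 := by
  rw [angularMomentum, ← Complex.normSq_eq_norm_sq, div_eq_mul_inv, Complex.inv_def, ← mul_assoc,
    Complex.im_mul_ofReal, mul_comm (deriv y t), div_eq_mul_inv]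

theorem deriv_eq_radial_add_angular {e : ℂ} (hne : y t ≠ 0) (he : y t = ‖y t‖ * e) :
    deriv y t =
      (radialMomentum y t / ‖y t‖) • e + (angularMomentum y t / ‖y t‖) • (Complex.I * e) := by
  have hr : (‖y t‖ : ℂ) ≠ 0 := by simpa using hne
  have hparts : (radialMomentum y t : ℂ) + angularMomentum y t * Complex.I =
    conj (y t) * deriv y t := Complex.re_add_im _
  have hmul : y t * (conj (y t) * deriv y t) = ‖y t‖ ^ 2 * deriv y t := by
    rw [← mul_assoc, Complex.mul_conj, Complex.normSq_eq_norm_sq, Complex.ofReal_pow]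
  rw [← hparts] at hmul
  simp only [Complex.real_smul, Complex.ofReal_div]
  field_simp
  apply mul_left_cancel₀ hr
  nth_rewrite 1 [he] at hmul
  linear_combination -hmul

end Kinematics

section CollisionEjection

variable {α m₁ φm φp t : ℝ}

theorem mu_pos (hα : 0 < α) (hm : 0 < m₁) : 0 < mu α m₁ := by
  unfold mu
  positivity

theorem two_div_mul_mu (hα : 0 < α) (hm : 0 < m₁) :
    2 / (α + 2) * mu α m₁ = √(2 * m₁ / α) := by
  have hsq : 2 * m₁ / α = 2 ^ 2 * (m₁ / (2 * α)) := by field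
  rw [hsq, Real.sqrt_mul (by positivity), Real.sqrt_sq zero_le_two, mu, ← Real.sqrt_eq_rpow]
  field

theorem collisionEjection_of_nonneg (ht : 0 ≤ t) :
    collisionEjection α m₁ φm φp t =
      (mu α m₁ * |t|) ^ (2 / (α + 2)) • Complex.exp (φp * Complex.I) := by
  rw [collisionEjection, if_pos ht, Complex.real_smul]

theorem collisionEjection_zero (hα : 0 < α) : collisionEjection α m₁ φm φp 0 = 0 := by
  rw [collisionEjection_of_nonneg le_rfl, abs_zero, mul_zero, Real.zero_rpow (by positivity),
    zero_smul]

theorem deriv_collisionEjection_of_pos (hμ : 0 < mu α m₁) (ht : 0 < t) :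
    deriv (collisionEjection α m₁ φm φp) t =
      (2 / (α + 2) * mu α m₁ * (mu α m₁ * |t|) ^ (2 / (α + 2) - 1)) •
        Complex.exp (φp * Complex.I) := by
  have hpow : HasDerivAt (fun s => (mu α m₁ * s) ^ (2 / (α + 2)))
      (2 / (α + 2) * mu α m₁ * (mu α m₁ * |t|) ^ (2 / (α + 2) - 1)) t := by
    refine (((hasDerivAt_id' t).const_mul (mu α m₁)).rpow_const (p := 2 / (α + 2))
      (Or.inl (mul_pos hμ ht).ne')).congr_deriv ?_
    rw [abs_of_pos ht]
    ring
  refine ((hpow.smul_const _).congr_of_eventuallyEq ?_).deriv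
  filter_upwards [Ioi_mem_nhds ht] with s hs
  rw [collisionEjection_of_nonneg (le_of_lt hs), abs_of_pos hs]

theorem collisionEjection_neg (ht : t ≠ 0) :
    collisionEjection α m₁ φm φp (-t) = collisionEjection α m₁ φp φm t := by
  rcases ht.lt_or_gt with h | h
  · simp [collisionEjection, h.le, h.not_ge]
  · simp [collisionEjection, h.le, h.not_ge]

theorem deriv_collisionEjection_neg (ht : t ≠ 0) :
    deriv (collisionEjection α m₁ φm φp) (-t) = -deriv (collisionEjection α m₁ φp φm) t := by
  have hneg : (fun s => collisionEjection α m₁ φm φp (-s)) =ᶠ[𝓝 t]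
      collisionEjection α m₁ φp φm := by
    filter_upwards [isOpen_ne.mem_nhds ht] with s hs using collisionEjection_neg hs
  rw [← hneg.deriv_eq, deriv_comp_neg, neg_neg]

theorem isPosHomogeneous_collisionEjection (hμ : 0 ≤ mu α m₁) :
    IsPosHomogeneous (2 / (α + 2)) (collisionEjection α m₁ φm φp) := by
  intro r hr t
  have hpow : (mu α m₁ * |r * t|) ^ (2 / (α + 2)) =
      r ^ (2 / (α + 2)) * (mu α m₁ * |t|) ^ (2 / (α + 2)) := by
    rw [abs_mul, abs_of_pos hr, mul_left_comm,
      Real.mul_rpow hr.le (mul_nonneg hμ (abs_nonneg t))]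
  simp only [collisionEjection, smul_eq_mul, hpow, mul_nonneg_iff_of_pos_left hr, smul_ite,
    Complex.real_smul, Complex.ofReal_mul, mul_assoc]

theorem continuous_collisionEjection (hα : 0 < α) :
    Continuous (collisionEjection α m₁ φm φp) := by
  have hpow : Continuous fun t : ℝ => (((mu α m₁ * |t|) ^ (2 / (α + 2)) : ℝ) : ℂ) :=
    Complex.continuous_ofReal.comp
      ((continuous_const.mul continuous_abs).rpow_const fun _ => Or.inr (by positivity))
  refine (hpow.mul continuous_const).if_le (hpow.mul continuous_const) continuous_const
    continuous_id ?_
  rintro t rfl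
  simp [Real.zero_rpow (show 2 / (α + 2) ≠ 0 by positivity)]

theorem rescale_eq_smul (α r : ℝ) (y : ℝ → ℂ) :
    rescale α r y = fun t => r ^ (-(2 / (α + 2))) • y (r • t) := by
  ext t
  rw [rescale, add_comm, Complex.real_smul, smul_eq_mul]

theorem deriv_rescale {r : ℝ} (hr : 0 < r) (α : ℝ) (y : ℝ → ℂ) :
    deriv (rescale α r y) = fun t => r ^ (-(2 / (α + 2) - 1)) • deriv y (r • t) := by
  ext t
  rw [rescale_eq_smul, deriv_fun_const_smul_field, neg_sub, sub_eq_neg_add, Real.rpow_add hr,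
    Real.rpow_one, mul_smul]
  simp only [smul_eq_mul, deriv_comp_mul_left]

end CollisionEjection

section PerturbedCollision

/-- The perturbation term in Newton's equation `y'' = -m₁ * y / ‖y‖ ^ (α + 2) + perturbation` of a
Kepler-type problem centred at the origin, as a function of time along the curve `y`. -/
noncomputable def perturbation (α m₁ : ℝ) (y : ℝ → ℂ) (t : ℝ) : ℂ :=
  deriv (deriv y) t + (m₁ / ‖y t‖ ^ (α + 2)) • y t

/-- Near time `0` on the right, `y` is ejected from a collision with the origin and solves a
Kepler-type problem up to bounded perturbations of the equation of motion and of the energy. -/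
structure IsPerturbedCollision (α m₁ : ℝ) (y : ℝ → ℂ) : Prop where
  tendsto_zero : Tendsto y (𝓝[>] 0) (𝓝 0)
  ne_zero : ∀ᶠ t in 𝓝[>] 0, y t ≠ 0
  differentiableAt : ∀ᶠ t in 𝓝[>] 0, DifferentiableAt ℝ y t
  differentiableAt_deriv : ∀ᶠ t in 𝓝[>] 0, DifferentiableAt ℝ (deriv y) t
  perturbation_isBigO : perturbation α m₁ y =O[𝓝[>] 0] fun _ => (1 : ℝ)
  energy_isBigO : (fun t => 1 / 2 * ‖deriv y t‖ ^ 2 - m₁ / (α * ‖y t‖ ^ α)) =O[𝓝[>] 0]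
    fun _ => (1 : ℝ)

variable {α m₁ : ℝ} {y : ℝ → ℂ}

theorem conj_mul_deriv_deriv {t : ℝ} (α m₁ : ℝ) (hne : y t ≠ 0) :
    conj (y t) * deriv (deriv y) t =
      (-(m₁ / ‖y t‖ ^ α) : ℝ) + conj (y t) * perturbation α m₁ y t := by
  have hr : 0 < ‖y t‖ := norm_pos_iff.2 hne
  have hself : conj (y t) * ((m₁ / ‖y t‖ ^ (α + 2)) • y t) = (m₁ / ‖y t‖ ^ α : ℝ) := by
    rw [mul_smul_comm, ← Complex.normSq_eq_conj_mul_self, Complex.normSq_eq_norm_sq,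
      Complex.real_smul, ← Complex.ofReal_mul, Real.rpow_add hr, Real.rpow_two]
    congr 1
    field
  rw [perturbation, mul_add, hself]
  push_cast
  ring

namespace IsPerturbedCollision

theorem tendsto_norm_rpow (h : IsPerturbedCollision α m₁ y) {p : ℝ} (hp : 0 < p) :
    Tendsto (fun t => ‖y t‖ ^ p) (𝓝[>] 0) (𝓝 0) := by
  simpa [Real.zero_rpow hp.ne'] using h.tendsto_zero.norm.rpow_const (Or.inr hp.le)

theorem tendsto_rpow_mul_norm_deriv_sq (h : IsPerturbedCollision α m₁ y) (hα : 0 < α) :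
    Tendsto (fun t => ‖y t‖ ^ α * ‖deriv y t‖ ^ 2) (𝓝[>] 0) (𝓝 (2 * m₁ / α)) := by
  have henergy : Tendsto (fun t => ‖y t‖ ^ α * (1 / 2 * ‖deriv y t‖ ^ 2 -
      m₁ / (α * ‖y t‖ ^ α))) (𝓝[>] 0) (𝓝 0) :=
    (h.tendsto_norm_rpow hα).zero_mul_isBoundedUnder_le
      ((isBigO_one_iff ℝ).1 h.energy_isBigO)
  have hlim := (henergy.const_mul 2).add_const (2 * m₁ / α)
  rw [mul_zero, zero_add] at hlim
  refine hlim.congr' ?_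
  filter_upwards [h.ne_zero] with t ht
  have hr := (Real.rpow_pos_of_pos (norm_pos_iff.2 ht) α).ne'
  field

theorem tendsto_conj_mul_deriv (h : IsPerturbedCollision α m₁ y) (hα : 0 < α) (hα₂ : α < 2) :
    Tendsto (fun t => conj (y t) * deriv y t) (𝓝[>] 0) (𝓝 0) := by
  have hsq : Tendsto (fun t => ‖conj (y t) * deriv y t‖ ^ 2) (𝓝[>] 0) (𝓝 0) := by
    have hlim := (h.tendsto_norm_rpow (sub_pos.2 hα₂)).mul (h.tendsto_rpow_mul_norm_deriv_sq hα)
    rw [zero_mul] at hlim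
    refine hlim.congr' ?_
    filter_upwards [h.ne_zero] with t ht
    rw [← mul_assoc, ← Real.rpow_add (norm_pos_iff.2 ht), sub_add_cancel, Real.rpow_two, norm_mul,
      Complex.norm_conj, mul_pow]
  rw [tendsto_zero_iff_norm_tendsto_zero]
  simpa only [Real.sqrt_sq (norm_nonneg _), Real.sqrt_zero] using hsq.sqrt

theorem eventually_deriv_radialMomentum_pos (h : IsPerturbedCollision α m₁ y) (hα : 0 < α)
    (hα₂ : α < 2) (hm : 0 < m₁) :
    ∀ᶠ t in 𝓝[>] 0, 0 < ‖deriv y t‖ ^ 2 + (conj (y t) * deriv (deriv y) t).re := by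
  have hconj : Tendsto (fun t => conj (y t) * perturbation α m₁ y t) (𝓝[>] 0) (𝓝 0) :=
    Tendsto.zero_mul_isBoundedUnder_le
      (by simpa [Function.comp_def] using (Complex.continuous_conj.tendsto 0).comp h.tendsto_zero)
      ((isBigO_one_iff ℝ).1 h.perturbation_isBigO)
  have hlim : Tendsto (fun t => ‖y t‖ ^ α *
      (‖deriv y t‖ ^ 2 + (conj (y t) * deriv (deriv y) t).re)) (𝓝[>] 0)
      (𝓝 ((2 - α) / α * m₁)) := by
    have hsum := ((h.tendsto_rpow_mul_norm_deriv_sq hα).sub_const m₁).add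
      ((h.tendsto_norm_rpow hα).mul ((Complex.continuous_re.tendsto 0).comp hconj))
    have hval : 2 * m₁ / α - m₁ + 0 * Complex.re 0 = (2 - α) / α * m₁ := by
      rw [zero_mul]
      field
    rw [hval] at hsum
    refine hsum.congr' ?_
    filter_upwards [h.ne_zero] with t ht
    have hr := (Real.rpow_pos_of_pos (norm_pos_iff.2 ht) α).ne'
    rw [conj_mul_deriv_deriv α m₁ ht, Complex.add_re, Complex.ofReal_re, Function.comp_apply]
    field
  have hpos : 0 < (2 - α) / α * m₁ := mul_pos (div_pos (sub_pos.2 hα₂) hα) hm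
  filter_upwards [hlim.eventually_const_lt hpos] with t ht
  exact pos_of_mul_pos_right ht (by positivity)

theorem eventually_radialMomentum_pos (h : IsPerturbedCollision α m₁ y) (hα : 0 < α)
    (hα₂ : α < 2) (hm : 0 < m₁) : ∀ᶠ t in 𝓝[>] 0, 0 < radialMomentum y t := by
  have hderiv : ∀ᶠ t in 𝓝[>] 0, HasDerivAt (radialMomentum y) _ t :=
    (h.differentiableAt.and h.differentiableAt_deriv).mono
      fun t ht => hasDerivAt_radialMomentum ht.1 ht.2
  obtain ⟨b, hb, hmono⟩ := exists_strictMonoOn_Ioo_of_hasDerivAt_pos hderiv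
    (h.eventually_deriv_radialMomentum_pos hα hα₂ hm)
  filter_upwards [Ioo_mem_nhdsGT hb] with t ht
  exact lt_of_strictMonoOn_Ioo_of_tendsto_nhdsGT hmono
    ((Complex.continuous_re.tendsto 0).comp (h.tendsto_conj_mul_deriv hα hα₂)) ht

theorem exists_strictMonoOn_norm (h : IsPerturbedCollision α m₁ y) (hα : 0 < α)
    (hα₂ : α < 2) (hm : 0 < m₁) : ∃ b > 0, StrictMonoOn (fun t => ‖y t‖) (Ioo 0 b) := by
  refine exists_strictMonoOn_Ioo_of_hasDerivAt_pos
    (f' := fun t => radialMomentum y t / ‖y t‖) ?_ ?_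
  · filter_upwards [h.differentiableAt, h.ne_zero] with t ht hne
    exact hasDerivAt_norm_radialMomentum ht hne
  · filter_upwards [h.eventually_radialMomentum_pos hα hα₂ hm, h.ne_zero] with t ht hne
    exact div_pos ht (norm_pos_iff.2 hne)

theorem angularMomentum_isBigO (h : IsPerturbedCollision α m₁ y) (hα : 0 < α)
    (hα₂ : α < 2) (hm : 0 < m₁) :
    angularMomentum y =O[𝓝[>] 0] fun t => ‖y t‖ * t := by
  have hlim : Tendsto (angularMomentum y) (𝓝[>] 0) (𝓝 0) :=
    (Complex.continuous_im.tendsto 0).comp (h.tendsto_conj_mul_deriv hα hα₂)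
  obtain ⟨C, hC⟩ := h.perturbation_isBigO.bound
  obtain ⟨b, hb, hmono⟩ := h.exists_strictMonoOn_norm hα hα₂ hm
  obtain ⟨d, hd, H⟩ := (nhdsGT_basis 0).eventually_iff.1 (hC.and
    (h.ne_zero.and (h.differentiableAt.and h.differentiableAt_deriv)))
  refine IsBigO.of_bound C ?_
  filter_upwards [Ioo_mem_nhdsGT (lt_min hb hd)] with t ht
  have htb : t ∈ Ioo 0 b := ⟨ht.1, ht.2.trans_le (min_le_left _ _)⟩
  have htd : ∀ s ∈ Ioc 0 t, s ∈ Ioo 0 d :=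
    fun s hs => ⟨hs.1, hs.2.trans_lt (ht.2.trans_le (min_le_right _ _))⟩
  have hbound : ∀ s ∈ Ioc 0 t, ‖(conj (y s) * deriv (deriv y) s).im‖ ≤ C * ‖y t‖ := by
    intro s hs
    obtain ⟨hps, hne, -⟩ := H (htd s hs)
    rw [conj_mul_deriv_deriv α m₁ hne, Complex.add_im, Complex.ofReal_im, zero_add]
    calc ‖(conj (y s) * perturbation α m₁ y s).im‖
        ≤ ‖y s‖ * ‖perturbation α m₁ y s‖ := by
          simpa using Complex.abs_im_le_norm (conj (y s) * perturbation α m₁ y s)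
      _ ≤ ‖y t‖ * C := by
          gcongr
          · exact hmono.monotoneOn ⟨hs.1, hs.2.trans_lt htb.2⟩ htb hs.2
          · simpa using hps
      _ = C * ‖y t‖ := mul_comm _ _
  have hvar := norm_sub_le_of_tendsto_nhdsGT ht.1 (fun s hs =>
    hasDerivAt_angularMomentum (H (htd s hs)).2.2.1 (H (htd s hs)).2.2.2) hbound hlim
  rwa [sub_zero, sub_zero, mul_assoc, ← norm_norm (y t), ← Real.norm_of_nonneg ht.1.le,
    ← norm_mul, Real.norm_of_nonneg ht.1.le] at hvar

theorem angularMomentum_div_norm_isBigO (h : IsPerturbedCollision α m₁ y) (hα : 0 < α)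
    (hα₂ : α < 2) (hm : 0 < m₁) :
    (fun t => angularMomentum y t / ‖y t‖) =O[𝓝[>] 0] fun t => t := by
  refine ((h.angularMomentum_isBigO hα hα₂ hm).mul
    (isBigO_refl (fun t => ‖y t‖⁻¹) _)).congr' (.of_forall fun t => (div_eq_mul_inv _ _).symm) ?_
  filter_upwards [h.ne_zero] with t ht
  rw [mul_comm ‖y t‖, mul_inv_cancel_right₀ (norm_ne_zero_iff.2 ht)]

theorem tendsto_angularMomentum_div_norm (h : IsPerturbedCollision α m₁ y) (hα : 0 < α)
    (hα₂ : α < 2) (hm : 0 < m₁) :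
    Tendsto (fun t => angularMomentum y t / ‖y t‖) (𝓝[>] 0) (𝓝 0) :=
  (h.angularMomentum_div_norm_isBigO hα hα₂ hm).trans_tendsto nhdsWithin_le_nhds

/-- Energy conservation fixes the speed, and the angular momentum takes a negligible part of it. -/
theorem tendsto_rpow_mul_radialMomentum_div_norm (h : IsPerturbedCollision α m₁ y) (hα : 0 < α)
    (hα₂ : α < 2) (hm : 0 < m₁) :
    Tendsto (fun t => ‖y t‖ ^ (α / 2) * (radialMomentum y t / ‖y t‖)) (𝓝[>] 0)
      (𝓝 √(2 * m₁ / α)) := by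
  have hsq := (h.tendsto_rpow_mul_norm_deriv_sq hα).sub ((h.tendsto_norm_rpow hα).mul
    ((h.tendsto_angularMomentum_div_norm hα hα₂ hm).pow 2))
  simp only [zero_mul, sub_zero] at hsq
  refine hsq.sqrt.congr' ?_
  filter_upwards [h.ne_zero, h.eventually_radialMomentum_pos hα hα₂ hm] with t hne hpos
  have hr : 0 < ‖y t‖ := norm_pos_iff.2 hne
  have hspeed : ‖deriv y t‖ ^ 2 =
      (radialMomentum y t / ‖y t‖) ^ 2 + (angularMomentum y t / ‖y t‖) ^ 2 := by
    rw [div_pow, div_pow, ← add_div, radialMomentum_sq_add_angularMomentum_sq,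
      mul_div_cancel_left₀ _ (by positivity)]
  rw [hspeed, mul_add, add_sub_cancel_right, Real.sqrt_mul (by positivity),
    Real.sqrt_sq (by positivity), Real.sqrt_eq_rpow, ← Real.rpow_mul hr.le, mul_one_div]

theorem tendsto_norm_rpow_div (h : IsPerturbedCollision α m₁ y) (hα : 0 < α)
    (hα₂ : α < 2) (hm : 0 < m₁) :
    Tendsto (fun t => ‖y t‖ ^ ((α + 2) / 2) / t) (𝓝[>] 0) (𝓝 (mu α m₁)) := by
  have hderiv : ∀ᶠ t in 𝓝[>] 0, HasDerivAt (fun s => ‖y s‖ ^ ((α + 2) / 2))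
      ((α + 2) / 2 * (‖y t‖ ^ (α / 2) * (radialMomentum y t / ‖y t‖))) t := by
    filter_upwards [h.differentiableAt, h.ne_zero] with t ht hne
    refine ((hasDerivAt_norm_radialMomentum ht hne).rpow_const
      (Or.inl (norm_ne_zero_iff.2 hne))).congr_deriv ?_
    rw [show (α + 2) / 2 - 1 = α / 2 by ring]
    ring
  refine HasDerivAt.lhopital_zero_nhdsGT hderiv (.of_forall fun t => hasDerivAt_id' t)
    (.of_forall fun _ => one_ne_zero) (h.tendsto_norm_rpow (by positivity)) nhdsWithin_le_nhds ?_
  have hmu : mu α m₁ = (α + 2) / 2 * √(2 * m₁ / α) := by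
    rw [← two_div_mul_mu hα hm]
    field
  simpa only [div_one, hmu] using
    (h.tendsto_rpow_mul_radialMomentum_div_norm hα hα₂ hm).const_mul ((α + 2) / 2)

theorem norm_rpow_isEquivalent (h : IsPerturbedCollision α m₁ y) (hα : 0 < α)
    (hα₂ : α < 2) (hm : 0 < m₁) (p : ℝ) :
    (fun t => ‖y t‖ ^ p) ~[𝓝[>] 0] fun t => (mu α m₁ * |t|) ^ (2 / (α + 2) * p) := by
  have hμ := mu_pos hα hm
  have hbase : (fun t => ‖y t‖ ^ ((α + 2) / 2)) ~[𝓝[>] 0] fun t => mu α m₁ * |t| := by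
    refine isEquivalent_of_tendsto_one ?_
    have hlim := (h.tendsto_norm_rpow_div hα hα₂ hm).div_const (mu α m₁)
    rw [div_self hμ.ne'] at hlim
    refine hlim.congr' ?_
    filter_upwards [self_mem_nhdsWithin] with t ht
    rw [Pi.div_apply, abs_of_pos ht, div_div, mul_comm t]
  refine (hbase.rpow (r := 2 / (α + 2) * p) fun t => by positivity).congr_left
    (.of_forall fun t => ?_)
  rw [Pi.pow_apply, ← Real.rpow_mul (norm_nonneg _)]
  congr 1
  field

theorem norm_isEquivalent (h : IsPerturbedCollision α m₁ y) (hα : 0 < α)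
    (hα₂ : α < 2) (hm : 0 < m₁) :
    (fun t => ‖y t‖) ~[𝓝[>] 0] fun t => (mu α m₁ * |t|) ^ (2 / (α + 2)) := by
  simpa only [Real.rpow_one, mul_one] using h.norm_rpow_isEquivalent hα hα₂ hm 1

theorem radialMomentum_div_norm_isEquivalent (h : IsPerturbedCollision α m₁ y) (hα : 0 < α)
    (hα₂ : α < 2) (hm : 0 < m₁) :
    (fun t => radialMomentum y t / ‖y t‖) ~[𝓝[>] 0]
      fun t => 2 / (α + 2) * mu α m₁ * (mu α m₁ * |t|) ^ (2 / (α + 2) - 1) := by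
  have hconst : 2 / (α + 2) * mu α m₁ ≠ 0 := mul_ne_zero (by positivity) (mu_pos hα hm).ne'
  have hlim := h.tendsto_rpow_mul_radialMomentum_div_norm hα hα₂ hm
  rw [← two_div_mul_mu hα hm] at hlim
  have hexp : 2 / (α + 2) * -(α / 2) = 2 / (α + 2) - 1 := by field
  have hpow := h.norm_rpow_isEquivalent hα hα₂ hm (-(α / 2))
  rw [hexp] at hpow
  refine (((isEquivalent_const_iff_tendsto hconst).2 hlim).mul hpow).congr_left ?_
  filter_upwards [h.ne_zero] with t ht
  have hr : 0 < ‖y t‖ := norm_pos_iff.2 ht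
  rw [Pi.mul_apply, mul_right_comm, ← Real.rpow_add hr, add_neg_cancel, Real.rpow_zero, one_mul]

theorem angularMomentum_div_norm_isLittleO (h : IsPerturbedCollision α m₁ y) (hα : 0 < α)
    (hα₂ : α < 2) (hm : 0 < m₁) :
    (fun t => angularMomentum y t / ‖y t‖) =o[𝓝[>] 0] fun t => radialMomentum y t / ‖y t‖ := by
  have hone : (fun _ => (1 : ℝ)) =O[𝓝[>] 0] fun t => radialMomentum y t / ‖y t‖ := by
    have hc : √(2 * m₁ / α) ≠ 0 := (Real.sqrt_pos.2 (by positivity)).ne'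
    have hlim := (isEquivalent_const_iff_tendsto hc).2
      (h.tendsto_rpow_mul_radialMomentum_div_norm hα hα₂ hm)
    have hpow := (h.tendsto_norm_rpow (half_pos hα)).isBigO_one ℝ
    refine (isBigO_const_const 1 hc _).trans (hlim.isBigO_symm.trans ?_)
    simpa only [one_mul] using hpow.mul (isBigO_refl (fun t => radialMomentum y t / ‖y t‖) _)
  exact ((isLittleO_one_iff ℝ).2 (h.tendsto_angularMomentum_div_norm hα hα₂ hm)).trans_isBigO hone

theorem id_isLittleO_norm (h : IsPerturbedCollision α m₁ y) (hα : 0 < α)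
    (hα₂ : α < 2) (hm : 0 < m₁) : (fun t => t) =o[𝓝[>] 0] fun t => ‖y t‖ := by
  have hlim := (h.tendsto_norm_rpow (half_pos hα)).div (h.tendsto_norm_rpow_div hα hα₂ hm)
    (mu_pos hα hm).ne'
  rw [zero_div] at hlim
  refine (isLittleO_iff_tendsto' (h.ne_zero.mono fun t ht h0 =>
    absurd (norm_eq_zero.1 h0) ht)).2 (hlim.congr' ?_)
  filter_upwards [h.ne_zero] with t ht
  have hr : 0 < ‖y t‖ := norm_pos_iff.2 ht
  rw [Pi.div_apply, show (α + 2) / 2 = α / 2 + 1 by ring, Real.rpow_add_one hr.ne', ← div_mul,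
    div_mul_eq_mul_div, mul_div_mul_left _ _ (Real.rpow_pos_of_pos hr _).ne']

theorem exists_tendsto_polarAngle (h : IsPerturbedCollision α m₁ y) (hα : 0 < α)
    (hα₂ : α < 2) (hm : 0 < m₁) {θ : ℝ → ℝ} (hθ : ∀ᶠ t in 𝓝[>] 0, ContinuousAt θ t)
    (hpolar : ∀ᶠ t in 𝓝[>] 0, y t = ‖y t‖ * Complex.exp (θ t * Complex.I)) :
    ∃ θ₀, Tendsto θ (𝓝[>] 0) (𝓝 θ₀) := by
  have hderiv : ∀ᶠ t in 𝓝[>] 0, HasDerivAt θ (angularMomentum y t / ‖y t‖ ^ 2) t := by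
    filter_upwards [h.differentiableAt, h.ne_zero, hθ, eventually_eventually_nhdsWithin.2 hpolar,
      self_mem_nhdsWithin] with t hy hne hθt hpt ht
    rw [← im_deriv_div_eq_angularMomentum_div]
    rw [nhdsWithin_eq_nhds.2 (Ioi_mem_nhds ht)] at hpt
    exact hasDerivAt_polarAngle hy.hasDerivAt hne hθt hpt
  refine exists_tendsto_nhdsGT_of_hasDerivAt_isBigO_one hderiv ?_
  have hratio : (fun t => t / ‖y t‖) =O[𝓝[>] 0] fun _ => (1 : ℝ) :=
    (h.id_isLittleO_norm hα hα₂ hm).tendsto_div_nhds_zero.isBigO_one ℝ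
  refine IsBigO.trans ?_ hratio
  refine ((h.angularMomentum_div_norm_isBigO hα hα₂ hm).mul
    (isBigO_refl (fun t => ‖y t‖⁻¹) _)).congr_left fun t => ?_
  ring

theorem isEquivalent_collisionEjection (h : IsPerturbedCollision α m₁ y) (hα : 0 < α)
    (hα₂ : α < 2) (hm : 0 < m₁) {θ : ℝ → ℝ} {θ₀ : ℝ} (hθ : Tendsto θ (𝓝[>] 0) (𝓝 θ₀))
    (hpolar : ∀ᶠ t in 𝓝[>] 0, y t = ‖y t‖ * Complex.exp (θ t * Complex.I)) (φ : ℝ) :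
    y ~[𝓝[>] 0] collisionEjection α m₁ φ θ₀ := by
  refine ((h.norm_isEquivalent hα hα₂ hm).smul (exp_mul_I_isEquivalent hθ)).congr_left ?_
    |>.congr_right ?_
  · filter_upwards [hpolar] with t ht
    rw [Complex.real_smul, ← ht]
  · filter_upwards [self_mem_nhdsWithin] with t ht
    rw [collisionEjection_of_nonneg (le_of_lt ht)]

theorem deriv_isEquivalent_deriv_collisionEjection (h : IsPerturbedCollision α m₁ y) (hα : 0 < α)
    (hα₂ : α < 2) (hm : 0 < m₁) {θ : ℝ → ℝ} {θ₀ : ℝ} (hθ : Tendsto θ (𝓝[>] 0) (𝓝 θ₀))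
    (hpolar : ∀ᶠ t in 𝓝[>] 0, y t = ‖y t‖ * Complex.exp (θ t * Complex.I)) (φ : ℝ) :
    deriv y ~[𝓝[>] 0] deriv (collisionEjection α m₁ φ θ₀) := by
  have hradial := (h.radialMomentum_div_norm_isEquivalent hα hα₂ hm).smul
    (exp_mul_I_isEquivalent hθ)
  have hangular : (fun t => (angularMomentum y t / ‖y t‖) •
      (Complex.I * Complex.exp (θ t * Complex.I))) =o[𝓝[>] 0]
      fun t => (radialMomentum y t / ‖y t‖) • Complex.exp (θ t * Complex.I) :=
    (h.angularMomentum_div_norm_isLittleO hα hα₂ hm).smul_isBigO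
      ((isBigO_refl _ _).const_mul_left Complex.I)
  refine (hradial.add_isLittleO (hangular.trans_isBigO hradial.isBigO)).congr_left ?_
    |>.congr_right ?_
  · filter_upwards [h.ne_zero, hpolar] with t hne ht
    exact (deriv_eq_radial_add_angular hne ht).symm
  · filter_upwards [self_mem_nhdsWithin] with t ht
    rw [deriv_collisionEjection_of_pos (mu_pos hα hm) ht]

end IsPerturbedCollision

end PerturbedCollision

section NCenterProblem

variable {N : ℕ} {α δ t₀ t : ℝ} {m : Fin N → ℝ} {c : Fin N → ℂ} {k : Fin N} {y : ℝ → ℂ}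

theorem continuousAt_force_add (α : ℝ) (m : Fin N → ℝ) (hc : ∀ j ≠ k, c j ≠ c k) :
    ContinuousAt (fun z => force α m c z + (m k / ‖z - c k‖ ^ (α + 2)) • (z - c k)) (c k) := by
  have hsum : ContinuousAt (fun z => -∑ j ∈ Finset.univ.erase k,
      (m j / ‖z - c j‖ ^ (α + 2)) • (z - c j)) (c k) := by
    refine (tendsto_finsetSum _ fun j hj => ?_).neg
    have hne : ‖c k - c j‖ ≠ 0 := norm_ne_zero_iff.2
      (sub_ne_zero.2 (hc j (Finset.ne_of_mem_erase hj)).symm)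
    have hsub : ContinuousAt (fun z => z - c j) (c k) := by fun_prop
    exact (continuousAt_const.div (hsub.norm.rpow_const (Or.inl hne)) (by positivity)).smul hsub
  refine hsum.congr (.of_forall fun z => ?_)
  simp only [force]
  rw [← Finset.add_sum_erase _ _ (Finset.mem_univ k)]
  abel

theorem continuousAt_potential_sub (m : Fin N → ℝ) (hα : α ≠ 0) (hc : ∀ j ≠ k, c j ≠ c k) :
    ContinuousAt (fun z => potential α m c z - m k / (α * ‖z - c k‖ ^ α)) (c k) := by
  have hsum : ContinuousAt (fun z => ∑ j ∈ Finset.univ.erase k, m j / (α * ‖z - c j‖ ^ α))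
      (c k) := by
    refine tendsto_finsetSum _ fun j hj => ?_
    have hne : ‖c k - c j‖ ≠ 0 := norm_ne_zero_iff.2
      (sub_ne_zero.2 (hc j (Finset.ne_of_mem_erase hj)).symm)
    have hsub : ContinuousAt (fun z => z - c j) (c k) := by fun_prop
    exact continuousAt_const.div (continuousAt_const.mul (hsub.norm.rpow_const (Or.inl hne)))
      (mul_ne_zero hα (by positivity))
  refine hsum.congr (.of_forall fun z => ?_)
  simp only [potential]
  rw [← Finset.add_sum_erase _ _ (Finset.mem_univ k), add_sub_cancel_left]

namespace IsIsolatedCollisionSolution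

theorem comp_neg (hy : IsIsolatedCollisionSolution α m c t₀ δ y) :
    IsIsolatedCollisionSolution α m c (-t₀) δ fun t => y (-t) := by
  have hneg : -Icc (-t₀ - δ) (-t₀ + δ) = Icc (t₀ - δ) (t₀ + δ) := by
    rw [neg_Icc]
    congr 1 <;> ring
  have hmaps : MapsTo Neg.neg (Icc (-t₀ - δ) (-t₀ + δ)) (Icc (t₀ - δ) (t₀ + δ)) :=
    fun t ht => hneg ▸ Set.neg_mem_neg.2 ht
  have hderiv : derivWithin (fun t => y (-t)) (Icc (-t₀ - δ) (-t₀ + δ)) =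
      fun t => -derivWithin y (Icc (t₀ - δ) (t₀ + δ)) (-t) := by
    ext t
    rw [derivWithin_comp_neg, hneg]
  have hne : ∀ {t}, t ≠ -t₀ → -t ≠ t₀ := fun h h' => h (neg_eq_iff_eq_neg.1 h')
  refine ⟨hy.delta_pos, hy.continuousOn.comp continuousOn_neg hmaps, ?_, ?_, ?_, ?_, ?_⟩
  · simpa using hy.collision
  · exact fun t ht h => hy.collisionFree (-t) (hmaps ht) (hne h)
  · exact fun t ht h => (hy.differentiable (-t) (hmaps ht) (hne h)).comp t
      differentiableWithinAt_id.neg hmaps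
  · intro t ht h
    rw [hderiv]
    simpa [Function.comp_def] using ((hy.equation (-t) (hmaps ht) (hne h)).scomp t
      (hasDerivWithinAt_neg t _) hmaps).fun_neg
  · obtain ⟨h, hE⟩ := hy.energy
    refine ⟨h, fun t ht hts => ?_⟩
    rw [hderiv, norm_neg]
    exact hE (-t) (hmaps ht) (hne hts)

theorem continuousAt (hy : IsIsolatedCollisionSolution α m c t₀ δ y) : ContinuousAt y t₀ :=
  hy.continuousOn.continuousAt
    (Icc_mem_nhds (sub_lt_self _ hy.delta_pos) (lt_add_of_pos_right _ hy.delta_pos))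

theorem differentiableAt (hy : IsIsolatedCollisionSolution α m c t₀ δ y)
    (ht : t ∈ Ioo (t₀ - δ) (t₀ + δ)) (hne : t ≠ t₀) : DifferentiableAt ℝ y t :=
  (hy.differentiable t (Ioo_subset_Icc_self ht) hne).differentiableAt (Icc_mem_nhds ht.1 ht.2)

theorem hasDerivAt_deriv (hy : IsIsolatedCollisionSolution α m c t₀ δ y)
    (ht : t ∈ Ioo (t₀ - δ) (t₀ + δ)) (hne : t ≠ t₀) :
    HasDerivAt (deriv y) (force α m c (y t)) t := by
  refine ((hy.equation t (Ioo_subset_Icc_self ht) hne).hasDerivAt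
    (Icc_mem_nhds ht.1 ht.2)).congr_of_eventuallyEq ?_
  filter_upwards [Ioo_mem_nhds ht.1 ht.2] with s hs
  exact (derivWithin_of_mem_nhds (Icc_mem_nhds hs.1 hs.2)).symm

theorem exists_energy (hy : IsIsolatedCollisionSolution α m c t₀ δ y) :
    ∃ h : ℝ, ∀ t ∈ Ioo (t₀ - δ) (t₀ + δ), t ≠ t₀ →
      1 / 2 * ‖deriv y t‖ ^ 2 - potential α m c (y t) = h := by
  obtain ⟨h, hE⟩ := hy.energy
  refine ⟨h, fun t ht hne => ?_⟩
  rw [← derivWithin_of_mem_nhds (Icc_mem_nhds ht.1 ht.2)]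
  exact hE t (Ioo_subset_Icc_self ht) hne

theorem isPerturbedCollision (hy : IsIsolatedCollisionSolution α m c 0 δ y) (hα : 0 < α)
    (hc : ∀ j ≠ k, c j ≠ c k) (hk : c k = 0) (hy₀ : y 0 = c k) :
    IsPerturbedCollision α (m k) y := by
  have hint : ∀ᶠ t in 𝓝[>] 0, t ∈ Ioo (0 - δ) (0 + δ) ∧ t ≠ 0 := by
    filter_upwards [Ioo_mem_nhdsGT hy.delta_pos] with t ht
    exact ⟨⟨by linarith [ht.1, ht.2], by simpa using ht.2⟩, ht.1.ne'⟩
  have hlim : Tendsto y (𝓝[>] 0) (𝓝 (c k)) :=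
    hy₀ ▸ hy.continuousAt.tendsto.mono_left nhdsWithin_le_nhds
  refine ⟨hk ▸ hlim, ?_, ?_, ?_, ?_, ?_⟩
  · filter_upwards [hint] with t ht h0
    exact hy.collisionFree t (Ioo_subset_Icc_self ht.1) ht.2 ⟨k, hk.trans h0.symm⟩
  · exact hint.mono fun t ht => hy.differentiableAt ht.1 ht.2
  · exact hint.mono fun t ht => (hy.hasDerivAt_deriv ht.1 ht.2).differentiableAt
  · refine (((continuousAt_force_add α m hc).tendsto.comp hlim).isBigO_one ℝ).congr' ?_ .rfl
    filter_upwards [hint] with t ht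
    rw [perturbation, (hy.hasDerivAt_deriv ht.1 ht.2).deriv, Function.comp_apply, hk, sub_zero]
  · obtain ⟨h, hE⟩ := hy.exists_energy
    refine ((((continuousAt_potential_sub m hα.ne' hc).tendsto.comp hlim).const_add
      h).isBigO_one ℝ).congr' ?_ .rfl
    filter_upwards [hint] with t ht
    rw [← hE t ht.1 ht.2, Function.comp_apply, hk, sub_zero]
    ring

end IsIsolatedCollisionSolution

namespace IsPolarAngle

variable {θ : ℝ → ℝ}

theorem comp_neg (hθ : IsPolarAngle δ y θ) :
    IsPolarAngle δ (fun t => y (-t)) fun t => θ (-t) := by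
  have hmaps : MapsTo Neg.neg (Icc (-δ) δ \ {0}) (Icc (-δ) δ \ {0}) := by
    rintro t ⟨ht, h0⟩
    exact ⟨⟨neg_le_neg ht.2, neg_le.1 ht.1⟩, neg_ne_zero.2 h0⟩
  exact ⟨hθ.continuousOn.comp continuousOn_neg hmaps, fun t ht => hθ.polar (-t) (hmaps ht)⟩

theorem eventually_continuousAt (hθ : IsPolarAngle δ y θ) (hδ : 0 < δ) :
    ∀ᶠ t in 𝓝[>] 0, ContinuousAt θ t := by
  filter_upwards [Ioo_mem_nhdsGT hδ] with t ht
  exact hθ.continuousOn.continuousAt (inter_mem (Icc_mem_nhds (by linarith [ht.1]) ht.2)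
    (isOpen_compl_singleton.mem_nhds ht.1.ne'))

theorem eventually_polar (hθ : IsPolarAngle δ y θ) (hδ : 0 < δ) :
    ∀ᶠ t in 𝓝[>] 0, y t = ‖y t‖ * Complex.exp (θ t * Complex.I) := by
  filter_upwards [Ioo_mem_nhdsGT hδ] with t ht
  exact hθ.polar t ⟨⟨by linarith [ht.1], ht.2.le⟩, ht.1.ne'⟩

end IsPolarAngle

theorem IsIsolatedCollisionSolution.exists_right_asymptotics
    (hy : IsIsolatedCollisionSolution α m c 0 δ y) (hα : 0 < α) (hα₂ : α < 2) (hm : 0 < m k)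
    (hc : ∀ j ≠ k, c j ≠ c k) (hk : c k = 0) (hy₀ : y 0 = c k) {θ : ℝ → ℝ}
    (hθ : IsPolarAngle δ y θ) :
    ∃ θp, Tendsto θ (𝓝[>] 0) (𝓝 θp) ∧ ∀ φ,
      y ~[𝓝[>] 0] collisionEjection α (m k) φ θp ∧
      deriv y ~[𝓝[>] 0] deriv (collisionEjection α (m k) φ θp) := by
  have h := hy.isPerturbedCollision hα hc hk hy₀
  have hpolar := hθ.eventually_polar hy.delta_pos
  obtain ⟨θp, hθp⟩ := h.exists_tendsto_polarAngle hα hα₂ hm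
    (hθ.eventually_continuousAt hy.delta_pos) hpolar
  exact ⟨θp, hθp, fun φ => ⟨h.isEquivalent_collisionEjection hα hα₂ hm hθp hpolar φ,
    h.deriv_isEquivalent_deriv_collisionEjection hα hα₂ hm hθp hpolar φ⟩⟩

theorem IsIsolatedCollisionSolution.exists_left_asymptotics
    (hy : IsIsolatedCollisionSolution α m c 0 δ y) (hα : 0 < α) (hα₂ : α < 2) (hm : 0 < m k)
    (hc : ∀ j ≠ k, c j ≠ c k) (hk : c k = 0) (hy₀ : y 0 = c k) {θ : ℝ → ℝ}
    (hθ : IsPolarAngle δ y θ) :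
    ∃ θm, Tendsto θ (𝓝[<] 0) (𝓝 θm) ∧ ∀ φ,
      y ~[𝓝[<] 0] collisionEjection α (m k) θm φ ∧
      deriv y ~[𝓝[<] 0] deriv (collisionEjection α (m k) θm φ) := by
  have hneg : Tendsto (Neg.neg : ℝ → ℝ) (𝓝[<] 0) (𝓝[>] 0) := by
    simpa using tendsto_neg_nhdsLT (a := (0 : ℝ))
  obtain ⟨θm, hθm, hasymp⟩ := (neg_zero (G := ℝ) ▸ hy.comp_neg).exists_right_asymptotics hα hα₂
    hm hc hk (by simpa using hy₀) hθ.comp_neg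
  refine ⟨θm, by simpa [Function.comp_def] using hθm.comp hneg, fun φ => ?_⟩
  obtain ⟨hpos, hvel⟩ := hasymp φ
  constructor
  · refine ((hpos.comp_tendsto hneg).congr_left (.of_forall fun t => ?_)).congr_right ?_
    · simp
    · filter_upwards [self_mem_nhdsWithin] with t ht using collisionEjection_neg (ne_of_lt ht)
  · refine ((hvel.comp_tendsto hneg).neg.congr_left (.of_forall fun t => ?_)).congr_right ?_
    · simp [deriv_comp_neg]
    · filter_upwards [self_mem_nhdsWithin] with t ht
      rw [Function.comp_apply, deriv_collisionEjection_neg (ne_of_lt ht), neg_neg]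

end NCenterProblem

section CollisionBlowup

variable {α m₁ φm φp : ℝ} {y : ℝ → ℂ}

theorem tendstoLocallyUniformly_rescale (hα : 0 < α) (hμ : 0 ≤ mu α m₁)
    (hy : y ~[𝓝[≠] 0] collisionEjection α m₁ φm φp) (hy₀ : y 0 = 0) :
    TendstoLocallyUniformly (fun r => rescale α r y) (collisionEjection α m₁ φm φp) (𝓝[>] 0) := by
  have huniv : y ~[𝓝[univ] 0] collisionEjection α m₁ φm φp := by
    rw [← union_compl_self {(0 : ℝ)}, ← insert_eq]
    exact hy.isLittleO.insert (by simp [hy₀, collisionEjection_zero hα])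
  simp only [rescale_eq_smul, ← tendstoLocallyUniformlyOn_univ]
  exact (isPosHomogeneous_collisionEjection hμ).tendstoLocallyUniformlyOn_blowup
    (continuous_collisionEjection hα).continuousOn (fun _ _ _ _ => mem_univ _) huniv

theorem tendstoLocallyUniformlyOn_deriv_rescale (hμ : 0 ≤ mu α m₁)
    (hy : deriv y ~[𝓝[≠] 0] deriv (collisionEjection α m₁ φm φp)) :
    TendstoLocallyUniformlyOn (fun r => deriv (rescale α r y))
      (deriv (collisionEjection α m₁ φm φp)) (𝓝[>] 0) {0}ᶜ := by
  have hhom := (isPosHomogeneous_collisionEjection (φm := φm) (φp := φp) hμ).deriv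
  have hblowup := hhom.tendstoLocallyUniformlyOn_blowup hhom.continuousOn_compl_zero
    (fun r hr t ht => smul_ne_zero hr.ne' ht) hy
  intro u hu t ht
  obtain ⟨v, hv, H⟩ := hblowup u hu t ht
  refine ⟨v, hv, ?_⟩
  filter_upwards [H, self_mem_nhdsWithin] with r hr hpos
  rwa [deriv_rescale hpos]

end CollisionBlowup

end NCenter

open Filter Topology Asymptotics NCenter in
theorem mainTheorem7_general {N : ℕ} {α : ℝ} (hα : 0 < α) (hα₂ : α < 2)
    {m : Fin N → ℝ} {c : Fin N → ℂ} {k : Fin N} (hm : 0 < m k) (hc : ∀ j ≠ k, c j ≠ c k)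
    (hk : c k = 0) {δ : ℝ} {y : ℝ → ℂ} (hy : IsIsolatedCollisionSolution α m c 0 δ y)
    (hy₀ : y 0 = c k) {θ : ℝ → ℝ} (hθ : IsPolarAngle δ y θ) :
    ∃ θm θp : ℝ, Tendsto θ (𝓝[<] 0) (𝓝 θm) ∧ Tendsto θ (𝓝[>] 0) (𝓝 θp) ∧
      TendstoLocallyUniformly (fun r => rescale α r y)
        (collisionEjection α (m k) θm θp) (𝓝[>] 0) ∧
      TendstoLocallyUniformlyOn (fun r => deriv (rescale α r y))
        (deriv (collisionEjection α (m k) θm θp)) (𝓝[>] 0) {0}ᶜ := by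
  obtain ⟨θm, hθm, hleft⟩ := hy.exists_left_asymptotics hα hα₂ hm hc hk hy₀ hθ
  obtain ⟨θp, hθp, hright⟩ := hy.exists_right_asymptotics hα hα₂ hm hc hk hy₀ hθ
  have hpos : y ~[𝓝[≠] 0] collisionEjection α (m k) θm θp :=
    nhdsLT_sup_nhdsGT (0 : ℝ) ▸ (hleft θp).1.isLittleO.sup (hright θm).1.isLittleO
  have hvel : deriv y ~[𝓝[≠] 0] deriv (collisionEjection α (m k) θm θp) :=
    nhdsLT_sup_nhdsGT (0 : ℝ) ▸ (hleft θp).2.isLittleO.sup (hright θm).2.isLittleO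
  have hμ := (mu_pos hα hm).le
  exact ⟨θm, θp, hθm, hθp, tendstoLocallyUniformly_rescale hα hμ hpos (hy₀.trans hk),
    tendstoLocallyUniformlyOn_deriv_rescale hμ hvel⟩

theorem mainTheorem7 {N : ℕ} (α : ℝ) (hα₁ : 1 ≤ α) (hα₂ : α < 2)
    (m : Fin N → ℝ) (hm : ∀ j, 0 < m j)
    (c : Fin N → ℂ) (hc : Function.Injective c)
    (k : Fin N) (hk : c k = 0)
    (δ : ℝ) (y : ℝ → ℂ) (hy : NCenter.IsIsolatedCollisionSolution α m c 0 δ y)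
    (hy₀ : y 0 = c k)
    (θ : ℝ → ℝ) (hθ : NCenter.IsPolarAngle δ y θ) :
    ∃ θm θp : ℝ,
      Filter.Tendsto θ (nhdsWithin 0 (Set.Iio 0)) (nhds θm) ∧
      Filter.Tendsto θ (nhdsWithin 0 (Set.Ioi 0)) (nhds θp) ∧
      ∀ T : ℝ, 0 < T →
        ∃ r : ℕ → ℝ,
          StrictAnti r ∧ (∀ n, 0 < r n) ∧ Filter.Tendsto r Filter.atTop (nhds 0) ∧
          -- the rescaled curves are defined on a neighbourhood of `[-T, T]`
          (∀ n, r n * T < δ) ∧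
          TendstoUniformlyOn (fun n => NCenter.rescale α (r n) y)
            (NCenter.collisionEjection α (m k) θm θp) Filter.atTop (Set.Icc (-T) T) ∧
          ∀ K : Set ℝ, IsCompact K → K ⊆ Set.Icc (-T) T \ {0} →
            TendstoUniformlyOn (fun n => deriv (NCenter.rescale α (r n) y))
              (deriv (NCenter.collisionEjection α (m k) θm θp)) Filter.atTop K := by
  obtain ⟨θm, θp, hθm, hθp, hpos, hvel⟩ := mainTheorem7_general (by linarith) hα₂ (hm k)
    (fun j hj => hc.ne hj) hk hy hy₀ hθ
  rw [tendstoLocallyUniformly_iff_forall_isCompact] at hpos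
  rw [tendstoLocallyUniformlyOn_iff_forall_isCompact isOpen_compl_singleton] at hvel
  refine ⟨θm, θp, hθm, hθp, fun T hT => ?_⟩
  obtain ⟨r, hanti, hr, hlim⟩ := exists_seq_strictAnti_tendsto' (div_pos hy.delta_pos hT)
  have hlim' : Filter.Tendsto r Filter.atTop (nhdsWithin 0 (Set.Ioi 0)) :=
    tendsto_nhdsWithin_iff.2 ⟨hlim, .of_forall fun n => (hr n).1⟩
  refine ⟨r, hanti, fun n => (hr n).1, hlim, fun n => (lt_div_iff₀ hT).1 (hr n).2, ?_, ?_⟩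
  · exact fun u hu => hlim'.eventually (hpos _ isCompact_Icc u hu)
  · exact fun K hK hKT u hu => hlim'.eventually (hvel K (fun t ht => (hKT ht).2) hK u hu)
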